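/- Let $\mathcal M=(\mathcal S,\mathcal A,P,r,H,\rho)$ be an episodic Markov decision process with finite state and action spaces, horizon $H\ge 2$, initial distribution $\rho$, transition functions $P_h(\cdot|s,a)$ and rewards $r_h(s,a)\in[0,1]$, $h\in[H]=\{1,\dots,H\}$. A policy $\pi=(\pi_1,\dots,\pi_H)\in\Pi$ consists of maps $\pi_h$ from states to distributions on actions. Rolling out $\pi$ gives a random trajectory $(s_1,a_1,\dots,s_H,a_H)$ with $s_1\sim\rho$, $a_h\sim\pi_h(\cdot|s_h)$, $s_{h+1}\sim P_h(\cdot|s_h,a_h)$; let $d^\pi_h(s,a)$ be the probability that $(s_h,a_h)=(s,a)$ and $V(\pi)=\mathbb E\big[\sum_{h=1}^H r_h(s_h,a_h)\big]$. Let $\pi^{\mathrm E}$ be an expert policy, and let the instance $(\mathcal M,\pi^{\mathrm E})$ be an RBAS MDP, i.e. $\mathcal S$ is the disjoint union of a set $\mathcal S^{\mathrm G}$ of good and a set $\mathcal S^{\mathrm B}$ of bad states, and there is an action $a^1$ such that for all $h\in[H]$: * for $s\in\mathcal S^{\mathrm G}$: $\pi^{\mathrm E}_h(a^1|s)=1$,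 $r_h(s,a^1)=1$, and $r_h(s,a)=0$ for $a\ne a^1$; for $s\in\mathcal S^{\mathrm B}$: $r_h(s,a)=0$ for all $a$; * for $s,s'\in\mathcal S^{\mathrm G}$: $P_h(s'|s,a^1)>0$, and $P_h(s'|s,a)=0$ for $a\neq a^1$; * for $b\in\mathcal S^{\mathrm B}$ and every action $a$: $\sum_{b'\in\mathcal S^{\mathrm B}}P_h(b'|b,a)=1$; * the expert never visits bad states: $d^{\pi^{\mathrm E}}_h(b,a)=0$ for all $b\in\mathcal S^{\mathrm B}$, $a\in\mathcal A$. Let $\mathcal D$ be a dataset of $N\ge1$ independent trajectories of $\pi^{\mathrm E}$, and let $\widehat{d}_h(s,a)$ be the fraction of the trajectories in $\mathcal D$ whose state-action pair at step $h$ is $(s,a)$. Let $\varepsilon\in\mathbb R$ and let $\bar\pi=\bar\pi(\mathcal D)$ be a policy depending on the dataset such that almost surely (over $\mathcal D$) * $\bar\pi$ is an $\varepsilon$-optimal solution of TV-AIL: $\sum_{h=1}^H\|d_h^{\bar\pi}-\widehat d_h\|_1\le\min_{\pi\in\Pi}\sum_{h=1}^H\|d_h^{\pi}-\widehat d_h\|_1+\varepsilon$,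 where $\|\cdot\|_1$ is the $\ell_1$ norm on $\mathcal S\times\mathcal A$; * for every $h\in[H]$ there is $s\in\mathcal S^{\mathrm G}$ with $\bar\pi_h(a^1|s)>0$. Define $$c(\bar\pi)=\min_{1\le\ell<h\le H,\; s,s'\in\mathcal S^{\mathrm G}}\mathbb P^{\bar\pi}\big(s_h=s\,\big|\,s_\ell=s',a_\ell=a^1\big),$$ where the probability is that of being in $s$ at step $h$ when starting from $s'$ with action $a^1$ at step $\ell$ and following $\bar\pi$ afterwards, and let $\varepsilon'=8\varepsilon/c(\bar\pi)$. Then $c(\bar\pi)>0$ almost surely, and there is a universal constant $C>0$ (independent of the MDP, of $|\mathcal S|,|\mathcal A|,H,N,\varepsilon$ and of $\bar\pi$) such that $$V(\pi^{\mathrm E})-\mathbb E\big[V(\bar\pi)\big]\;\le\; C\,\min\Big\{1+\mathbb E[\varepsilon'],\ \sqrt{\tfrac{|\mathcal S|}{N}}+\mathbb E[\varepsilon']\Big\},$$ where the expectations are over the randomness of the dataset $\mathcal D$. -/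

import Mathlib

open Finset

noncomputable section

/-- A tabular episodic MDP with finite state space `S`, finite action space `A` and horizon `H`.
Time steps are indexed by `Fin H`, so the step written `h` in `1, …, H` is the index `h - 1`. -/
structure TabularMDP (S A : Type*) [Fintype S] [Fintype A] (H : ℕ) where
  /-- initial state distribution -/
  init : S → ℝ
  init_mem : init ∈ stdSimplex ℝ S
  /-- `trans h s a s'` is the probability of moving to `s'` from `(s, a)` in step `h` -/
  trans : Fin H → S → A → S → ℝ
  trans_mem : ∀ h s a, trans h s a ∈ stdSimplex ℝ S
  /-- deterministic rewards -/
  reward : Fin H → S → A → ℝ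
  reward_mem : ∀ h s a, reward h s a ∈ Set.Icc (0 : ℝ) 1

/-- A non-stationary stochastic policy; `prob h s a` is the probability of action `a` in state `s`
at step `h`. -/
structure Policy (S A : Type*) [Fintype A] (H : ℕ) where
  prob : Fin H → S → A → ℝ
  prob_mem : ∀ h s, prob h s ∈ stdSimplex ℝ A

/-- Trajectories `(s₁, a₁, …, s_H, a_H)`. -/
abbrev Trajectory (S A : Type*) (H : ℕ) := Fin H → S × A

/-- Datasets of `N` trajectories. -/
abbrev Dataset (S A : Type*) (H N : ℕ) := Fin N → Trajectory S A H

namespace TabularMDP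

variable {S A : Type*} [Fintype S] [Fintype A] {H N : ℕ}

/-- The probability with which the environment produces the state of step `h` of `tr`, given the
earlier part of `tr`: the initial distribution in the first step, the transition function later. -/
def arrivalProb (M : TabularMDP S A H) (tr : Trajectory S A H) (h : Fin H) : ℝ :=
  if (h : ℕ) = 0 then M.init (tr h).1
  else
    M.trans ⟨h - 1, by omega⟩ (tr ⟨h - 1, by omega⟩).1 (tr ⟨h - 1, by omega⟩).2 (tr h).1

/-- The probability of a trajectory when the policy `π` is rolled out:
`ρ(s₁) π₁(a₁|s₁) ∏ P_h(s_{h+1}|s_h, a_h) π_{h+1}(a_{h+1}|s_{h+1})`. -/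
def trajProb (M : TabularMDP S A H) (π : Policy S A H) (tr : Trajectory S A H) : ℝ :=
  ∏ h : Fin H, M.arrivalProb tr h * π.prob h (tr h).1 (tr h).2

/-- The policy value: the expected sum of rewards along a trajectory. -/
def value [DecidableEq S] [DecidableEq A] (M : TabularMDP S A H) (π : Policy S A H) : ℝ :=
  ∑ tr : Trajectory S A H, M.trajProb π tr * ∑ h : Fin H, M.reward h (tr h).1 (tr h).2

/-- The state-action distribution `d_h^π(s, a)`: the probability of `(s_h, a_h) = (s, a)`. -/
def occupancy [DecidableEq S] [DecidableEq A] (M : TabularMDP S A H) (π : Policy S A H)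
    (h : Fin H) (s : S) (a : A) : ℝ :=
  ∑ tr : Trajectory S A H with tr h = (s, a), M.trajProb π tr

/-- The distribution of the state reached `k + 1` steps after taking action `a` in state `s'` at
step `ℓ`, the actions of the steps after `ℓ` being drawn from `π` (zero past the horizon). -/
def visitAfter (M : TabularMDP S A H) (π : Policy S A H) (ℓ : Fin H) (s' : S) (a : A) :
    ℕ → S → ℝ
  | 0, s => M.trans ℓ s' a s
  | k + 1, s =>
    if hk : (ℓ : ℕ) + k + 1 < H then
      ∑ x : S, ∑ b : A, M.visitAfter π ℓ s' a k x * π.prob ⟨ℓ + k + 1, hk⟩ x b *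
        M.trans ⟨ℓ + k + 1, hk⟩ x b s
    else 0

/-- The visitation probability `ℙ^π(s_h = s | s_ℓ = s', a_ℓ = a)`, for `ℓ < h`: the probability of
being in `s` at step `h` when starting from `(s', a)` at step `ℓ`. -/
def visitProb (M : TabularMDP S A H) (π : Policy S A H) (ℓ h : Fin H) (s' : S) (a : A) (s : S) :
    ℝ :=
  M.visitAfter π ℓ s' a ((h : ℕ) - ℓ - 1) s

/-- RBAS instances (reachable bad absorbing states): `good` is the set of good states, its
complement the set of bad states, `a₁` the expert action on good states and `πE` the expert. -/
structure IsRBAS [DecidableEq S] [DecidableEq A] (M : TabularMDP S A H) (πE : Policy S A H)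
    (good : Finset S) (a₁ : A) : Prop where
  expert_action : ∀ h, ∀ s ∈ good, πE.prob h s a₁ = 1
  reward_expert : ∀ h, ∀ s ∈ good, M.reward h s a₁ = 1
  reward_nonexpert : ∀ h, ∀ s ∈ good, ∀ a, a ≠ a₁ → M.reward h s a = 0
  reward_bad : ∀ h, ∀ s ∉ good, ∀ a, M.reward h s a = 0
  trans_expert : ∀ h, ∀ s ∈ good, ∀ s' ∈ good, 0 < M.trans h s a₁ s'
  trans_nonexpert : ∀ h, ∀ s ∈ good, ∀ s' ∈ good, ∀ a, a ≠ a₁ → M.trans h s a s' = 0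
  bad_absorbing : ∀ h, ∀ b ∉ good, ∀ a, ∑ b' ∈ goodᶜ, M.trans h b a b' = 1
  expert_avoids_bad : ∀ h, ∀ b ∉ good, ∀ a, M.occupancy πE h b a = 0

/-- The candidate policies: in every step the expert action has positive probability at some good
state. -/
def IsCandidate (good : Finset S) (a₁ : A) (π : Policy S A H) : Prop :=
  ∀ h, ∃ s ∈ good, 0 < π.prob h s a₁

/-- The probability of a dataset of `N` independent trajectories generated by `πE`. -/
def datasetProb (M : TabularMDP S A H) (πE : Policy S A H) (D : Dataset S A H N) : ℝ :=
  ∏ i : Fin N, M.trajProb πE (D i)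

/-- The expectation of `f(D)` over a random dataset `D` of `N` independent expert trajectories. -/
def datasetExp [DecidableEq S] [DecidableEq A] (M : TabularMDP S A H) (πE : Policy S A H)
    (f : Dataset S A H N → ℝ) : ℝ :=
  ∑ D : Dataset S A H N, M.datasetProb πE D * f D

/-- The empirical state-action distribution of step `h`. -/
def empiricalDist [DecidableEq S] [DecidableEq A] (D : Dataset S A H N) (h : Fin H) (s : S)
    (a : A) : ℝ :=
  (#{i : Fin N | D i h = (s, a)} : ℝ) / N

/-- The TV-AIL objective `∑_h ‖d_h^π - \hat d_h‖₁`. -/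
def tvLoss [DecidableEq S] [DecidableEq A] (M : TabularMDP S A H) (D : Dataset S A H N)
    (π : Policy S A H) : ℝ :=
  ∑ h : Fin H, ∑ s : S, ∑ a : A, |M.occupancy π h s a - empiricalDist D h s a|

/-- `π` is an `ε`-optimal solution of TV-AIL on the dataset `D`. -/
def IsEpsOptimal [DecidableEq S] [DecidableEq A] (M : TabularMDP S A H) (D : Dataset S A H N)
    (ε : ℝ) (π : Policy S A H) : Prop :=
  ∀ π' : Policy S A H, M.tvLoss D π ≤ M.tvLoss D π' + ε

/-- `c(π)`: the minimum of `ℙ^π(s_h = s | s_ℓ = s', a_ℓ = a₁)` over steps `ℓ < h` and good states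
`s, s'`. The set is finite, and nonempty if `2 ≤ H` and there is a good state, so that the infimum
is a minimum. -/
def minVisitProb (M : TabularMDP S A H) (good : Finset S) (a₁ : A) (π : Policy S A H) : ℝ :=
  sInf {p : ℝ | ∃ ℓ h : Fin H, ℓ < h ∧ ∃ s ∈ good, ∃ s' ∈ good, p = M.visitProb π ℓ h s' a₁ s}

end TabularMDP

end

/-!
Good states are entered only by playing `a₁` in a good state, where the expert always plays it.
By induction over the steps, the occupancy of `(s, a₁)` for a good state `s` is therefore largest
under the expert. As the data lie in `good × {a₁}`, the `ℓ₁` distance between the occupancy measure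
of a policy and the empirical distribution is twice the empirical mass that the policy leaves
uncovered, and the expert minimises this uncovered mass at every step simultaneously.

The value of a policy is the sum over the steps of the probability of playing `a₁` in a good state.
If `π` loses probability `δ` in this way at step `h`, its occupancy at step `h + 1` falls short of
the expert's by at least `c δ` at every good state, where `c` bounds the one-step transition
probabilities between good states from below. This includes a state where the data reach the
occupancy of the expert, so the uncovered mass of `π` at step `h + 1` exceeds the expert's by `c δ`.
Optimality in TV-AIL bounds the total excess by `ε / 2`, hence the loss over all steps but the last
by `ε / (2c)`. The loss in the last step is at most the uncovered mass there, which is the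
expert's plus the excess. The mass left uncovered by the expert at a single step is a statistical
error: it is at most `1`, and at most `√(|S| / N)` in expectation by the variance of the empirical
distribution.
-/

section Paths

variable {R X : Type*} [CommSemiring R] {n : ℕ}

/-- The weight `μ(x₀) K₀(x₀, x₁) ⋯ Kₙ₋₁(xₙ₋₁, xₙ)` of a path under the initial weights `μ` and the
transition kernels `K`. For stochastic `μ` and `K` it is the law of an inhomogeneous Markov
chain. -/
def pathWeight (μ : X → R) (K : Fin n → X → X → R) (x : Fin (n + 1) → X) : R :=
  μ (x 0) * ∏ i, K i (x i.castSucc) (x i.succ)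

theorem pathWeight_snoc (μ : X → R) (K : Fin (n + 1) → X → X → R) (x : Fin (n + 1) → X) (y : X) :
    pathWeight μ K (Fin.snoc x y : Fin (n + 2) → X) =
      pathWeight μ (fun i => K i.castSucc) x * K (Fin.last n) (x (Fin.last n)) y := by
  simp only [pathWeight, Fin.prod_univ_castSucc, Fin.succ_castSucc, Fin.succ_last, Fin.snoc_last,
    ← Fin.castSucc_zero, Fin.snoc_castSucc, mul_assoc]

theorem sum_eq_sum_sum_snoc [Fintype X] (F : (Fin (n + 1) → X) → R) :
    ∑ x, F x = ∑ x : Fin n → X, ∑ y, F (Fin.snoc x y) := by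
  rw [← (Fin.snocEquiv fun _ => X).sum_comp, Fintype.sum_prod_type_right]
  rfl

theorem sum_pathWeight_mul_init [Fintype X] (μ : X → R) {K : Fin (n + 1) → X → X → R}
    (hK : ∀ i x, ∑ y, K i x y = 1) (g : (Fin (n + 1) → X) → R) :
    ∑ x, pathWeight μ K x * g (Fin.init x) =
      ∑ x, pathWeight μ (fun i => K i.castSucc) x * g x := by
  simp only [sum_eq_sum_sum_snoc (n := n + 1), pathWeight_snoc, Fin.init_snoc, ← sum_mul,
    ← mul_sum, hK, mul_one]

theorem sum_pathWeight_mul_apply_zero [Fintype X] (μ : X → R) {K : Fin n → X → X → R}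
    (hK : ∀ i x, ∑ y, K i x y = 1) (g : X → R) :
    ∑ x, pathWeight μ K x * g (x 0) = ∑ y, μ y * g y := by
  induction n with
  | zero =>
    rw [← (Equiv.funUnique (Fin 1) X).symm.sum_comp]
    simp [pathWeight]
  | succ n ih =>
    rw [← ih fun i => hK i.castSucc]
    exact sum_pathWeight_mul_init μ hK fun x => g (x 0)

theorem sum_pathWeight_mul_apply_succ [Fintype X] (μ : X → R) {K : Fin n → X → X → R}
    (hK : ∀ i x, ∑ y, K i x y = 1) (i : Fin n) (g : X → R) :
    ∑ x, pathWeight μ K x * g (x i.succ) =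
      ∑ x, pathWeight μ K x * ∑ y, K i (x i.castSucc) y * g y := by
  induction n with
  | zero => exact i.elim0
  | succ n ih =>
    have hinit := sum_pathWeight_mul_init μ hK
    induction i using Fin.lastCases with
    | last =>
      calc ∑ x, pathWeight μ K x * g (x (Fin.last n).succ)
          = ∑ x, pathWeight μ (fun j => K j.castSucc) x *
              ∑ y, K (Fin.last n) (x (Fin.last n)) y * g y := by
            simp only [sum_eq_sum_sum_snoc (n := n + 1), pathWeight_snoc, Fin.succ_last,
              Fin.snoc_last, mul_assoc, ← mul_sum]
        _ = ∑ x, pathWeight μ K x * ∑ y, K (Fin.last n) (x (Fin.last n).castSucc) y * g y :=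
            (hinit fun x => ∑ y, K (Fin.last n) (x (Fin.last n)) y * g y).symm
    | cast i =>
      calc ∑ x, pathWeight μ K x * g (x i.castSucc.succ)
          = ∑ x, pathWeight μ (fun j => K j.castSucc) x * g (x i.succ) :=
            hinit fun x => g (x i.succ)
        _ = ∑ x, pathWeight μ (fun j => K j.castSucc) x *
              ∑ y, K i.castSucc (x i.castSucc) y * g y := ih (fun j => hK j.castSucc) i
        _ = ∑ x, pathWeight μ K x * ∑ y, K i.castSucc (x i.castSucc.castSucc) y * g y :=
            (hinit fun x => ∑ y, K i.castSucc (x i.castSucc) y * g y).symm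

end Paths

section ProductWeights

variable {ι T R : Type*} [Fintype ι] [DecidableEq ι] [Fintype T]

theorem sum_prod_mul_mul_eq_ite [CommSemiring R] {w Z : T → R} (hw : ∑ t, w t = 1)
    (hZ : ∑ t, w t * Z t = 0) (i j : ι) :
    ∑ x : ι → T, (∏ k, w (x k)) * (Z (x i) * Z (x j)) =
      if i = j then ∑ t, w t * Z t ^ 2 else 0 := by
  have factor (x : ι → T) : (∏ k, w (x k)) * (Z (x i) * Z (x j)) =
      ∏ k, w (x k) * ((if k = i then Z (x k) else 1) * if k = j then Z (x k) else 1) := by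
    simp only [prod_mul_distrib, prod_ite_eq', mem_univ, if_true]
  simp_rw [factor, ← Fintype.prod_sum
    (f := fun k t => w t * ((if k = i then Z t else 1) * if k = j then Z t else 1))]
  split_ifs with hij
  · subst hij
    rw [Fintype.prod_eq_single i fun k hk => by simp [hk, hw]]
    simp [sq]
  · exact prod_eq_zero (mem_univ i) (by simp [hij, hZ])

theorem sum_prod_mul_sum_sq [CommSemiring R] {w Z : T → R} (hw : ∑ t, w t = 1)
    (hZ : ∑ t, w t * Z t = 0) :
    ∑ x : ι → T, (∏ i, w (x i)) * (∑ i, Z (x i)) ^ 2 =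
      Fintype.card ι * ∑ t, w t * Z t ^ 2 := by
  calc ∑ x : ι → T, (∏ i, w (x i)) * (∑ i, Z (x i)) ^ 2
      = ∑ i, ∑ j, ∑ x : ι → T, (∏ k, w (x k)) * (Z (x i) * Z (x j)) := by
        simp_rw [sq, sum_mul_sum, mul_sum]
        rw [sum_comm]
        exact sum_congr rfl fun i _ => sum_comm
    _ = Fintype.card ι * ∑ t, w t * Z t ^ 2 := by
        simp [sum_prod_mul_mul_eq_ite hw hZ]

theorem sum_mul_indicator_sub_eq_zero [CommRing R] {w : T → R} (hw : ∑ t, w t = 1) (p : T → Prop)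
    [DecidablePred p] : ∑ t, w t * ((if p t then 1 else 0) - ∑ u with p u, w u) = 0 := by
  simp [mul_sub, ← sum_mul, hw, sum_filter]

theorem sum_mul_indicator_sub_sq [CommRing R] {w : T → R} (hw : ∑ t, w t = 1) (p : T → Prop)
    [DecidablePred p] :
    ∑ t, w t * ((if p t then 1 else 0) - ∑ u with p u, w u) ^ 2 =
      (∑ t with p t, w t) * (1 - ∑ t with p t, w t) := by
  set q := ∑ t with p t, w t with hq
  have expand (t : T) : w t * ((if p t then 1 else 0) - q) ^ 2 =
      (1 - 2 * q) * (if p t then w t else 0) + w t * q ^ 2 := by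
    split_ifs <;> ring
  simp_rw [expand, sum_add_distrib, ← mul_sum, ← sum_mul, hw, ← sum_filter, ← hq]
  ring

end ProductWeights

theorem sum_abs_sub_eq_two_mul_sum_posPart {ι : Type*} {s : Finset ι} {p q : ι → ℝ}
    (h : ∑ i ∈ s, p i = ∑ i ∈ s, q i) :
    ∑ i ∈ s, |p i - q i| = 2 * ∑ i ∈ s, (q i - p i)⁺ := by
  have habs (i : ι) : |p i - q i| = 2 * (q i - p i)⁺ + (p i - q i) := by
    have hpos := abs_add_eq_two_nsmul_posPart (q i - p i)
    rw [nsmul_eq_mul, Nat.cast_ofNat] at hpos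
    rw [abs_sub_comm, ← hpos]
    ring
  simp_rw [habs, sum_add_distrib, sum_sub_distrib, h, sub_self, add_zero, mul_sum]

theorem sum_sum_eq_sum_of_eq_zero {ι κ R : Type*} [Fintype ι] [Fintype κ] [AddCommMonoid R]
    {s : Finset ι} {k : κ} {f : ι → κ → R} (hf : ∀ i j, ¬(i ∈ s ∧ j = k) → f i j = 0) :
    ∑ i, ∑ j, f i j = ∑ i ∈ s, f i k := by
  rw [← sum_subset (subset_univ s) fun i _ hi => sum_eq_zero fun j _ => hf i j fun h => hi h.1]
  exact sum_congr rfl fun i _ => Fintype.sum_eq_single k fun j hj => hf i j fun h => hj h.2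

namespace TabularMDP

section Occupancy

variable {S A : Type*} [Fintype S] [Fintype A] {H n : ℕ}

theorem trajProb_nonneg (M : TabularMDP S A H) (π : Policy S A H) (tr : Trajectory S A H) :
    0 ≤ M.trajProb π tr := by
  refine prod_nonneg fun h _ => mul_nonneg ?_ ((π.prob_mem h _).1 _)
  rw [arrivalProb]
  split_ifs
  · exact M.init_mem.1 _
  · exact (M.trans_mem _ _ _).1 _

theorem trajProb_eq_pathWeight (M : TabularMDP S A (n + 1)) (π : Policy S A (n + 1))
    (tr : Trajectory S A (n + 1)) :
    M.trajProb π tr = pathWeight (fun x => M.init x.1 * π.prob 0 x.1 x.2)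
      (fun h x y => M.trans h.castSucc x.1 x.2 y.1 * π.prob h.succ y.1 y.2) tr := by
  rw [trajProb, pathWeight, Fin.prod_univ_succ]
  rfl

theorem sum_trans_mul_prob (M : TabularMDP S A (n + 1)) (π : Policy S A (n + 1)) (h : Fin n)
    (x : S × A) :
    ∑ y : S × A, M.trans h.castSucc x.1 x.2 y.1 * π.prob h.succ y.1 y.2 = 1 := by
  simp_rw [Fintype.sum_prod_type, ← mul_sum, (π.prob_mem _ _).2, mul_one, (M.trans_mem _ _ _).2]

theorem sum_trajProb (M : TabularMDP S A H) (π : Policy S A H) :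
    ∑ tr : Trajectory S A H, M.trajProb π tr = 1 := by
  cases H with
  | zero => simp [trajProb]
  | succ n =>
    simpa [trajProb_eq_pathWeight, Fintype.sum_prod_type, ← mul_sum, (π.prob_mem _ _).2,
      M.init_mem.2] using
      sum_pathWeight_mul_apply_zero (fun x => M.init x.1 * π.prob 0 x.1 x.2)
        (M.sum_trans_mul_prob π) fun _ => 1

variable [DecidableEq S] [DecidableEq A]

theorem occupancy_nonneg (M : TabularMDP S A H) (π : Policy S A H) (h : Fin H) (s : S) (a : A) :
    0 ≤ M.occupancy π h s a :=
  sum_nonneg fun tr _ => M.trajProb_nonneg π tr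

theorem trajProb_le_occupancy (M : TabularMDP S A H) (π : Policy S A H) {tr : Trajectory S A H}
    {h : Fin H} {s : S} {a : A} (htr : tr h = (s, a)) :
    M.trajProb π tr ≤ M.occupancy π h s a :=
  single_le_sum (f := M.trajProb π) (fun tr _ => M.trajProb_nonneg π tr) (by simpa using htr)

theorem occupancy_eq_zero_of_prob_eq_zero (M : TabularMDP S A H) {π : Policy S A H} {h : Fin H}
    {s : S} {a : A} (hπ : π.prob h s a = 0) : M.occupancy π h s a = 0 := by
  refine sum_eq_zero fun tr htr => prod_eq_zero (mem_univ h) ?_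
  rw [(mem_filter.1 htr).2, hπ, mul_zero]

theorem sum_trajProb_mul_apply (M : TabularMDP S A H) (π : Policy S A H) (h : Fin H)
    (g : S → A → ℝ) :
    ∑ tr : Trajectory S A H, M.trajProb π tr * g (tr h).1 (tr h).2 =
      ∑ s, ∑ a, M.occupancy π h s a * g s a := by
  rw [← Fintype.sum_prod_type' fun s a => M.occupancy π h s a * g s a,
    ← sum_fiberwise univ fun tr : Trajectory S A H => tr h]
  refine sum_congr rfl fun x _ => ?_
  rw [occupancy, sum_mul]
  exact sum_congr rfl fun tr htr => by rw [(mem_filter.1 htr).2]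

theorem sum_occupancy (M : TabularMDP S A H) (π : Policy S A H) (h : Fin H) :
    ∑ s, ∑ a, M.occupancy π h s a = 1 := by
  simpa [M.sum_trajProb π] using (M.sum_trajProb_mul_apply π h fun _ _ => 1).symm

theorem sum_occupancy_le_one (M : TabularMDP S A H) (π : Policy S A H) (h : Fin H) (s : Finset S)
    (a : A) : ∑ x ∈ s, M.occupancy π h x a ≤ 1 := by
  rw [← M.sum_occupancy π h]
  calc ∑ x ∈ s, M.occupancy π h x a
      ≤ ∑ x, M.occupancy π h x a :=
        sum_le_sum_of_subset_of_nonneg (subset_univ s) fun x _ _ => M.occupancy_nonneg π h x a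
    _ ≤ ∑ x, ∑ b, M.occupancy π h x b := sum_le_sum fun x _ =>
        single_le_sum (fun b _ => M.occupancy_nonneg π h x b) (mem_univ a)

theorem value_eq_sum_occupancy_mul_reward (M : TabularMDP S A H) (π : Policy S A H) :
    M.value π = ∑ h, ∑ s, ∑ a, M.occupancy π h s a * M.reward h s a := by
  simp_rw [value, mul_sum]
  rw [sum_comm]
  exact sum_congr rfl fun h _ => M.sum_trajProb_mul_apply π h (M.reward h)

theorem occupancy_eq_sum_mul_ite (M : TabularMDP S A H) (π : Policy S A H) (h : Fin H) (s : S)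
    (a : A) : M.occupancy π h s a =
      ∑ tr : Trajectory S A H, M.trajProb π tr * if tr h = (s, a) then 1 else 0 := by
  simp [occupancy, sum_filter]

theorem occupancy_zero (M : TabularMDP S A (n + 1)) (π : Policy S A (n + 1)) (s : S) (a : A) :
    M.occupancy π 0 s a = M.init s * π.prob 0 s a := by
  simp_rw [occupancy_eq_sum_mul_ite, trajProb_eq_pathWeight]
  rw [sum_pathWeight_mul_apply_zero _ (M.sum_trans_mul_prob π) fun x =>
    if x = (s, a) then 1 else 0]
  simp

theorem occupancy_succ (M : TabularMDP S A (n + 1)) (π : Policy S A (n + 1)) (h : Fin n) (s : S)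
    (a : A) : M.occupancy π h.succ s a =
      (∑ x, ∑ b, M.occupancy π h.castSucc x b * M.trans h.castSucc x b s) *
        π.prob h.succ s a := by
  simp_rw [← M.sum_trajProb_mul_apply π h.castSucc fun x b => M.trans h.castSucc x b s,
    occupancy_eq_sum_mul_ite, trajProb_eq_pathWeight]
  rw [sum_pathWeight_mul_apply_succ _ (M.sum_trans_mul_prob π) h fun x =>
    if x = (s, a) then 1 else 0, sum_mul]
  simp [mul_assoc]

end Occupancy

section VisitProb

variable {S A : Type*} [Fintype S] [Fintype A] {H n : ℕ}

theorem visitAfter_nonneg (M : TabularMDP S A H) (π : Policy S A H) (ℓ : Fin H) (s' : S) (a : A)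
    (k : ℕ) (s : S) : 0 ≤ M.visitAfter π ℓ s' a k s := by
  induction k generalizing s with
  | zero => exact (M.trans_mem ℓ s' a).1 s
  | succ k ih =>
    rw [visitAfter]
    split_ifs
    · exact sum_nonneg fun x _ => sum_nonneg fun b _ =>
        mul_nonneg (mul_nonneg (ih x) ((π.prob_mem _ x).1 b)) ((M.trans_mem _ x b).1 s)
    · exact le_rfl

theorem visitProb_castSucc_succ (M : TabularMDP S A (n + 1)) (π : Policy S A (n + 1)) (h : Fin n)
    (s' : S) (a : A) (s : S) :
    M.visitProb π h.castSucc h.succ s' a s = M.trans h.castSucc s' a s := by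
  simp [visitProb, visitAfter]

theorem finite_setOf_visitProb (M : TabularMDP S A H) (good : Finset S) (a₁ : A)
    (π : Policy S A H) :
    {p : ℝ | ∃ ℓ h : Fin H, ℓ < h ∧ ∃ s ∈ good, ∃ s' ∈ good,
      p = M.visitProb π ℓ h s' a₁ s}.Finite := by
  refine (Set.finite_range fun x : Fin H × Fin H × S × S =>
    M.visitProb π x.1 x.2.1 x.2.2.2 a₁ x.2.2.1).subset ?_
  rintro p ⟨ℓ, h, -, s, -, s', -, rfl⟩
  exact ⟨(ℓ, h, s, s'), rfl⟩

theorem minVisitProb_le_visitProb (M : TabularMDP S A H) {good : Finset S} (a₁ : A)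
    (π : Policy S A H) {ℓ h : Fin H} (hℓ : ℓ < h) {s s' : S} (hs : s ∈ good) (hs' : s' ∈ good) :
    M.minVisitProb good a₁ π ≤ M.visitProb π ℓ h s' a₁ s :=
  csInf_le (M.finite_setOf_visitProb good a₁ π).bddBelow ⟨ℓ, h, hℓ, s, hs, s', hs', rfl⟩

theorem minVisitProb_le_trans (M : TabularMDP S A (n + 1)) {good : Finset S} (a₁ : A)
    (π : Policy S A (n + 1)) (h : Fin n) {s s' : S} (hs : s ∈ good) (hs' : s' ∈ good) :
    M.minVisitProb good a₁ π ≤ M.trans h.castSucc s' a₁ s :=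
  (M.minVisitProb_le_visitProb a₁ π h.castSucc_lt_succ hs hs').trans_eq
    (M.visitProb_castSucc_succ π h s' a₁ s)

end VisitProb

section Dataset

variable {S A : Type*} [Fintype S] [Fintype A] {H N : ℕ}

theorem datasetProb_nonneg (M : TabularMDP S A H) (πE : Policy S A H) (D : Dataset S A H N) :
    0 ≤ M.datasetProb πE D :=
  prod_nonneg fun i _ => M.trajProb_nonneg πE (D i)

theorem sum_datasetProb (M : TabularMDP S A H) (πE : Policy S A H) :
    ∑ D : Dataset S A H N, M.datasetProb πE D = 1 := by
  simp_rw [datasetProb, ← Fintype.sum_pow, sum_trajProb, one_pow]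

variable [DecidableEq S] [DecidableEq A]

theorem datasetExp_const (M : TabularMDP S A H) (πE : Policy S A H) (c : ℝ) :
    M.datasetExp πE (fun _ : Dataset S A H N => c) = c := by
  rw [datasetExp, ← sum_mul, sum_datasetProb, one_mul]

theorem datasetExp_add (M : TabularMDP S A H) (πE : Policy S A H) (f g : Dataset S A H N → ℝ) :
    M.datasetExp πE (fun D => f D + g D) = M.datasetExp πE f + M.datasetExp πE g := by
  simp only [datasetExp, mul_add, sum_add_distrib]

theorem datasetExp_const_mul (M : TabularMDP S A H) (πE : Policy S A H) (c : ℝ)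
    (f : Dataset S A H N → ℝ) :
    M.datasetExp πE (fun D => c * f D) = c * M.datasetExp πE f := by
  simp only [datasetExp, mul_sum, mul_left_comm]

theorem datasetExp_sum (M : TabularMDP S A H) (πE : Policy S A H) {ι : Type*} (s : Finset ι)
    (f : ι → Dataset S A H N → ℝ) :
    M.datasetExp πE (fun D => ∑ i ∈ s, f i D) = ∑ i ∈ s, M.datasetExp πE (f i) := by
  simp only [datasetExp, mul_sum]
  exact sum_comm

theorem datasetExp_mono {M : TabularMDP S A H} {πE : Policy S A H} {f g : Dataset S A H N → ℝ}
    (hfg : ∀ D, 0 < M.datasetProb πE D → f D ≤ g D) :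
    M.datasetExp πE f ≤ M.datasetExp πE g := by
  refine sum_le_sum fun D _ => ?_
  rcases (M.datasetProb_nonneg πE D).eq_or_lt' with hD | hD
  · simp [hD]
  · exact mul_le_mul_of_nonneg_left (hfg D hD) hD.le

theorem sq_datasetExp_le (M : TabularMDP S A H) (πE : Policy S A H) (f : Dataset S A H N → ℝ) :
    M.datasetExp πE f ^ 2 ≤ M.datasetExp πE fun D => f D ^ 2 :=
  Real.pow_arith_mean_le_arith_mean_pow_of_even univ _ f (fun D _ => M.datasetProb_nonneg πE D)
    (M.sum_datasetProb πE) even_two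

end Dataset

section EmpiricalDist

variable {S A : Type*} [DecidableEq S] [DecidableEq A] {H N : ℕ}

theorem empiricalDist_nonneg (D : Dataset S A H N) (h : Fin H) (s : S) (a : A) :
    0 ≤ empiricalDist D h s a := by
  rw [empiricalDist]
  positivity

variable [Fintype S] [Fintype A]

theorem sum_empiricalDist (hN : N ≠ 0) (D : Dataset S A H N) (h : Fin H) :
    ∑ s, ∑ a, empiricalDist D h s a = 1 := by
  simp only [empiricalDist, ← sum_div]
  rw [div_eq_one_iff_eq (Nat.cast_ne_zero.2 hN),
    ← Fintype.sum_prod_type' fun s a => (#{i | D i h = (s, a)} : ℝ), ← Nat.cast_sum,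
    ← card_eq_sum_card_fiberwise (f := fun i => D i h) (by simp [Set.MapsTo]), card_univ,
    Fintype.card_fin]

theorem empiricalDist_eq_zero_of_occupancy_eq_zero {M : TabularMDP S A H} {πE : Policy S A H}
    {D : Dataset S A H N} (hD : 0 < M.datasetProb πE D) {h : Fin H} {s : S} {a : A}
    (hocc : M.occupancy πE h s a = 0) : empiricalDist D h s a = 0 := by
  have hne (i : Fin N) : D i h ≠ (s, a) := fun hi =>
    hD.ne' <| prod_eq_zero (mem_univ i) <|
      ((M.trajProb_le_occupancy πE hi).trans_eq hocc).antisymm (M.trajProb_nonneg πE (D i))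
  simp [empiricalDist, hne]

theorem datasetExp_sq_empiricalDist_sub_occupancy_le (hN : N ≠ 0) (M : TabularMDP S A H)
    (πE : Policy S A H) (h : Fin H) (s : S) (a : A) :
    M.datasetExp πE (fun D : Dataset S A H N =>
      (empiricalDist D h s a - M.occupancy πE h s a) ^ 2) ≤ M.occupancy πE h s a / N := by
  have hN' : (N : ℝ) ≠ 0 := Nat.cast_ne_zero.2 hN
  set q := M.occupancy πE h s a
  have hsum := M.sum_trajProb πE
  have hdev (D : Dataset S A H N) : (empiricalDist D h s a - q) ^ 2 =
      ((N : ℝ) ^ 2)⁻¹ * (∑ i, ((if D i h = (s, a) then 1 else 0) - q)) ^ 2 := by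
    simp only [empiricalDist, sum_sub_distrib, sum_boole, sum_const, card_univ, Fintype.card_fin,
      nsmul_eq_mul]
    field_simp
  have hvar : M.datasetExp πE (fun D : Dataset S A H N =>
      (∑ i, ((if D i h = (s, a) then 1 else 0) - q)) ^ 2) = N * (q * (1 - q)) := by
    have hadd := sum_prod_mul_sum_sq (ι := Fin N) hsum
      (sum_mul_indicator_sub_eq_zero hsum fun tr => tr h = (s, a))
    rwa [sum_mul_indicator_sub_sq hsum, Fintype.card_fin] at hadd
  calc M.datasetExp πE (fun D : Dataset S A H N => (empiricalDist D h s a - q) ^ 2)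
      = ((N : ℝ) ^ 2)⁻¹ * (N * (q * (1 - q))) := by
        simp_rw [hdev, datasetExp_const_mul, hvar]
    _ = q * (1 - q) / N := by field_simp
    _ ≤ q / N := by
        gcongr
        nlinarith [sq_nonneg q]

end EmpiricalDist

section ExpertAction

variable {S A : Type*} [Fintype S] [Fintype A] [DecidableEq S] [DecidableEq A] {H N : ℕ}

/-- The probability that `π` takes the action `a₁` in a state of `good` at step `h`. -/
noncomputable def followProb (M : TabularMDP S A H) (π : Policy S A H) (good : Finset S) (a₁ : A)
    (h : Fin H) : ℝ :=
  ∑ s ∈ good, M.occupancy π h s a₁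

/-- The part of the empirical mass of `good × {a₁}` at step `h` in excess of the occupancy measure
of `π`. On RBAS instances the TV-AIL objective is twice the sum of these masses over all steps. -/
noncomputable def uncoveredMass (M : TabularMDP S A H) (π : Policy S A H) (good : Finset S)
    (a₁ : A) (D : Dataset S A H N) (h : Fin H) : ℝ :=
  ∑ s ∈ good, (empiricalDist D h s a₁ - M.occupancy π h s a₁)⁺

theorem uncoveredMass_le_one (hN : N ≠ 0) (M : TabularMDP S A H) (π : Policy S A H)
    (good : Finset S) (a₁ : A) (D : Dataset S A H N) (h : Fin H) :
    M.uncoveredMass π good a₁ D h ≤ 1 := by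
  rw [← sum_empiricalDist hN D h]
  calc M.uncoveredMass π good a₁ D h
      ≤ ∑ s ∈ good, empiricalDist D h s a₁ := sum_le_sum fun s _ =>
        sup_le (sub_le_self _ (M.occupancy_nonneg π h s a₁)) (empiricalDist_nonneg D h s a₁)
    _ ≤ ∑ s, empiricalDist D h s a₁ :=
        sum_le_sum_of_subset_of_nonneg (subset_univ good) fun s _ _ => empiricalDist_nonneg D h s a₁
    _ ≤ ∑ s, ∑ a, empiricalDist D h s a := sum_le_sum fun s _ =>
        single_le_sum (fun a _ => empiricalDist_nonneg D h s a) (mem_univ a₁)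

theorem datasetExp_uncoveredMass_le_sqrt (hN : N ≠ 0) (M : TabularMDP S A H) (πE : Policy S A H)
    (good : Finset S) (a₁ : A) (h : Fin H) :
    M.datasetExp πE (fun D : Dataset S A H N => M.uncoveredMass πE good a₁ D h) ≤
      √(#good / N) := by
  refine Real.le_sqrt_of_sq_le ?_
  have cauchy (D : Dataset S A H N) : M.uncoveredMass πE good a₁ D h ^ 2 ≤
      #good * ∑ s ∈ good, (empiricalDist D h s a₁ - M.occupancy πE h s a₁) ^ 2 := by
    refine sq_sum_le_card_mul_sum_sq.trans ?_
    refine mul_le_mul_of_nonneg_left (sum_le_sum fun s _ => ?_) (Nat.cast_nonneg _)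
    rw [sq_le_sq, abs_of_nonneg (posPart_nonneg _)]
    exact sup_le (le_abs_self _) (abs_nonneg _)
  calc M.datasetExp πE (fun D : Dataset S A H N => M.uncoveredMass πE good a₁ D h) ^ 2
      ≤ M.datasetExp πE fun D : Dataset S A H N => M.uncoveredMass πE good a₁ D h ^ 2 :=
        M.sq_datasetExp_le πE _
    _ ≤ #good * ∑ s ∈ good, M.datasetExp πE (fun D : Dataset S A H N =>
          (empiricalDist D h s a₁ - M.occupancy πE h s a₁) ^ 2) := by
        rw [← datasetExp_sum, ← datasetExp_const_mul]
        exact datasetExp_mono fun D _ => cauchy D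
    _ ≤ #good * ∑ s ∈ good, M.occupancy πE h s a₁ / N := by
        gcongr
        exact datasetExp_sq_empiricalDist_sub_occupancy_le hN M πE h _ a₁
    _ ≤ #good * (1 / N) := by
        rw [← sum_div]
        gcongr
        exact M.sum_occupancy_le_one πE h good a₁
    _ = #good / N := mul_one_div _ _

end ExpertAction

theorem IsEpsOptimal.nonneg {S A : Type*} [Fintype S] [Fintype A] [DecidableEq S] [DecidableEq A]
    {H N : ℕ} {M : TabularMDP S A H} {D : Dataset S A H N} {ε : ℝ} {π : Policy S A H}
    (hπ : M.IsEpsOptimal D ε π) : 0 ≤ ε :=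
  le_add_iff_nonneg_right _ |>.1 (hπ π)

namespace IsRBAS

variable {S A : Type*} [Fintype S] [Fintype A] [DecidableEq S] [DecidableEq A] {H N n : ℕ}

section Dynamics

variable {M : TabularMDP S A H} {πE : Policy S A H} {good : Finset S} {a₁ : A}

theorem reward_eq_zero (hM : M.IsRBAS πE good a₁) (h : Fin H) {s : S} {a : A}
    (hsa : ¬(s ∈ good ∧ a = a₁)) : M.reward h s a = 0 := by
  by_cases hs : s ∈ good
  · exact hM.reward_nonexpert h s hs a fun ha => hsa ⟨hs, ha⟩
  · exact hM.reward_bad h s hs a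

theorem trans_eq_zero (hM : M.IsRBAS πE good a₁) (h : Fin H) {s s' : S} {a : A}
    (hs' : s' ∈ good) (hsa : ¬(s ∈ good ∧ a = a₁)) : M.trans h s a s' = 0 := by
  by_cases hs : s ∈ good
  · exact hM.trans_nonexpert h s hs s' hs' a fun ha => hsa ⟨hs, ha⟩
  · have hsum : ∑ g ∈ good, M.trans h s a g = 0 := by
      linarith [sum_add_sum_compl good (M.trans h s a), hM.bad_absorbing h s hs a,
        (M.trans_mem h s a).2]
    exact (sum_eq_zero_iff_of_nonneg fun g _ => (M.trans_mem h s a).1 g).1 hsum s' hs'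

theorem expert_prob_eq_zero (hM : M.IsRBAS πE good a₁) (h : Fin H) {s : S} (hs : s ∈ good)
    {a : A} (ha : a ≠ a₁) : πE.prob h s a = 0 := by
  have hsum := (πE.prob_mem h s).2
  rw [← add_sum_erase univ _ (mem_univ a₁), hM.expert_action h s hs, add_eq_left] at hsum
  exact (sum_eq_zero_iff_of_nonneg fun b _ => (πE.prob_mem h s).1 b).1 hsum a (by simpa using ha)

theorem expert_occupancy_eq_zero (hM : M.IsRBAS πE good a₁) (h : Fin H) {s : S} {a : A}
    (hsa : ¬(s ∈ good ∧ a = a₁)) : M.occupancy πE h s a = 0 := by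
  by_cases hs : s ∈ good
  · exact M.occupancy_eq_zero_of_prob_eq_zero <|
      hM.expert_prob_eq_zero h hs fun ha => hsa ⟨hs, ha⟩
  · exact hM.expert_avoids_bad h s hs a

theorem followProb_expert (hM : M.IsRBAS πE good a₁) (h : Fin H) :
    M.followProb πE good a₁ h = 1 := by
  rw [← M.sum_occupancy πE h, followProb,
    sum_sum_eq_sum_of_eq_zero fun _ _ => hM.expert_occupancy_eq_zero h]

theorem good_nonempty (hM : M.IsRBAS πE good a₁) (h : Fin H) : good.Nonempty :=
  nonempty_of_sum_ne_zero ((hM.followProb_expert h).trans_ne one_ne_zero)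

theorem value_eq_sum_followProb (hM : M.IsRBAS πE good a₁) (π : Policy S A H) :
    M.value π = ∑ h, M.followProb π good a₁ h := by
  rw [value_eq_sum_occupancy_mul_reward]
  refine sum_congr rfl fun h _ => ?_
  rw [sum_sum_eq_sum_of_eq_zero fun s a hsa => by rw [hM.reward_eq_zero h hsa, mul_zero]]
  exact sum_congr rfl fun s hs => by rw [hM.reward_expert h s hs, mul_one]

theorem occupancy_succ {M : TabularMDP S A (n + 1)} {πE : Policy S A (n + 1)}
    (hM : M.IsRBAS πE good a₁) (π : Policy S A (n + 1)) (h : Fin n) {s : S} (hs : s ∈ good) :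
    M.occupancy π h.succ s a₁ =
      (∑ x ∈ good, M.occupancy π h.castSucc x a₁ * M.trans h.castSucc x a₁ s) *
        π.prob h.succ s a₁ := by
  rw [TabularMDP.occupancy_succ, sum_sum_eq_sum_of_eq_zero fun x b hxb => by
    rw [hM.trans_eq_zero h.castSucc hs hxb, mul_zero]]

theorem occupancy_le_expert (hM : M.IsRBAS πE good a₁) (π : Policy S A H) (h : Fin H) {s : S}
    (hs : s ∈ good) : M.occupancy π h s a₁ ≤ M.occupancy πE h s a₁ := by
  have hprob (h : Fin H) (s : S) (hs : s ∈ good) : π.prob h s a₁ ≤ πE.prob h s a₁ :=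
    (mem_Icc_of_mem_stdSimplex (π.prob_mem h s) a₁).2.trans_eq (hM.expert_action h s hs).symm
  cases H with
  | zero => exact h.elim0
  | succ n =>
    induction h using Fin.induction generalizing s with
    | zero =>
      simp_rw [occupancy_zero]
      exact mul_le_mul_of_nonneg_left (hprob 0 s hs) (M.init_mem.1 s)
    | succ h ih =>
      simp_rw [hM.occupancy_succ _ h hs]
      have htrans (x : S) : 0 ≤ M.trans h.castSucc x a₁ s := (M.trans_mem _ x a₁).1 s
      gcongr with x hx
      · exact (π.prob_mem _ s).1 a₁
      · exact sum_nonneg fun x _ => mul_nonneg (M.occupancy_nonneg πE _ x a₁) (htrans x)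
      · exact htrans x
      · exact ih hx
      · exact hprob _ s hs

theorem uncoveredMass_expert_le (hM : M.IsRBAS πE good a₁) (π : Policy S A H)
    (D : Dataset S A H N) (h : Fin H) :
    M.uncoveredMass πE good a₁ D h ≤ M.uncoveredMass π good a₁ D h :=
  sum_le_sum fun _ hs => posPart_mono (sub_le_sub_left (hM.occupancy_le_expert π h hs) _)

end Dynamics

section Dataset

variable {M : TabularMDP S A H} {πE : Policy S A H} {good : Finset S} {a₁ : A}
  {D : Dataset S A H N}

theorem empiricalDist_eq_zero (hM : M.IsRBAS πE good a₁) (hD : 0 < M.datasetProb πE D)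
    (h : Fin H) {s : S} {a : A} (hsa : ¬(s ∈ good ∧ a = a₁)) : empiricalDist D h s a = 0 :=
  empiricalDist_eq_zero_of_occupancy_eq_zero hD (hM.expert_occupancy_eq_zero h hsa)

theorem sum_good_empiricalDist (hM : M.IsRBAS πE good a₁) (hN : N ≠ 0)
    (hD : 0 < M.datasetProb πE D) (h : Fin H) : ∑ s ∈ good, empiricalDist D h s a₁ = 1 := by
  rw [← sum_empiricalDist hN D h,
    sum_sum_eq_sum_of_eq_zero fun _ _ => hM.empiricalDist_eq_zero hD h]

theorem tvLoss_eq_two_mul_sum_uncoveredMass (hM : M.IsRBAS πE good a₁) (hN : N ≠ 0)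
    (hD : 0 < M.datasetProb πE D) (π : Policy S A H) :
    M.tvLoss D π = 2 * ∑ h, M.uncoveredMass π good a₁ D h := by
  rw [tvLoss, mul_sum]
  refine sum_congr rfl fun h _ => ?_
  have htotal : ∑ x : S × A, M.occupancy π h x.1 x.2 = ∑ x : S × A, empiricalDist D h x.1 x.2 := by
    rw [Fintype.sum_prod_type', Fintype.sum_prod_type', M.sum_occupancy, sum_empiricalDist hN]
  rw [← Fintype.sum_prod_type' fun s a => |M.occupancy π h s a - empiricalDist D h s a|,
    sum_abs_sub_eq_two_mul_sum_posPart htotal, uncoveredMass,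
    Fintype.sum_prod_type' fun s a => (empiricalDist D h s a - M.occupancy π h s a)⁺,
    sum_sum_eq_sum_of_eq_zero fun s a hsa => by
      rw [hM.empiricalDist_eq_zero hD h hsa, zero_sub, posPart_eq_zero, neg_nonpos]
      exact M.occupancy_nonneg π h s a]

theorem one_sub_followProb_le_uncoveredMass (hM : M.IsRBAS πE good a₁) (hN : N ≠ 0)
    (hD : 0 < M.datasetProb πE D) (π : Policy S A H) (h : Fin H) :
    1 - M.followProb π good a₁ h ≤ M.uncoveredMass π good a₁ D h := by
  rw [← hM.sum_good_empiricalDist hN hD h, followProb, ← sum_sub_distrib]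
  exact sum_le_sum fun s _ => le_posPart _

end Dataset

section OneStep

variable {M : TabularMDP S A (n + 1)} {πE : Policy S A (n + 1)} {good : Finset S} {a₁ : A}
  {D : Dataset S A (n + 1) N} {c : ℝ}

theorem mul_one_sub_followProb_le_occupancy_sub (hM : M.IsRBAS πE good a₁)
    (π : Policy S A (n + 1)) {h : Fin n} {s : S} (hs : s ∈ good)
    (hc : ∀ x ∈ good, c ≤ M.trans h.castSucc x a₁ s) :
    c * (1 - M.followProb π good a₁ h.castSucc) ≤
      M.occupancy πE h.succ s a₁ - M.occupancy π h.succ s a₁ := by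
  have hπ : M.occupancy π h.succ s a₁ ≤
      ∑ x ∈ good, M.occupancy π h.castSucc x a₁ * M.trans h.castSucc x a₁ s := by
    rw [hM.occupancy_succ π h hs]
    exact mul_le_of_le_one_right
      (sum_nonneg fun x _ => mul_nonneg (M.occupancy_nonneg π _ x a₁) ((M.trans_mem _ x a₁).1 s))
      (mem_Icc_of_mem_stdSimplex (π.prob_mem _ s) a₁).2
  calc c * (1 - M.followProb π good a₁ h.castSucc)
      = ∑ x ∈ good, (M.occupancy πE h.castSucc x a₁ - M.occupancy π h.castSucc x a₁) * c := by
        rw [← hM.followProb_expert h.castSucc, followProb, followProb, ← sum_mul,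
          sum_sub_distrib, mul_comm]
    _ ≤ ∑ x ∈ good, (M.occupancy πE h.castSucc x a₁ - M.occupancy π h.castSucc x a₁) *
          M.trans h.castSucc x a₁ s := sum_le_sum fun x hx =>
        mul_le_mul_of_nonneg_left (hc x hx) (sub_nonneg.2 (hM.occupancy_le_expert π _ hx))
    _ ≤ M.occupancy πE h.succ s a₁ - M.occupancy π h.succ s a₁ := by
        rw [hM.occupancy_succ πE h hs, hM.expert_action h.succ s hs, mul_one]
        simp_rw [sub_mul, sum_sub_distrib]
        exact sub_le_sub_left hπ _

theorem mul_one_sub_followProb_le_uncoveredMass_sub (hM : M.IsRBAS πE good a₁) (hN : N ≠ 0)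
    (hD : 0 < M.datasetProb πE D) (π : Policy S A (n + 1)) {h : Fin n}
    (hc : ∀ s ∈ good, ∀ x ∈ good, c ≤ M.trans h.castSucc x a₁ s) :
    c * (1 - M.followProb π good a₁ h.castSucc) ≤
      M.uncoveredMass π good a₁ D h.succ - M.uncoveredMass πE good a₁ D h.succ := by
  -- Both sides have total mass one, so the data reach the expert's occupancy at some good state.
  obtain ⟨s, hs, hle⟩ : ∃ s ∈ good, M.occupancy πE h.succ s a₁ ≤ empiricalDist D h.succ s a₁ :=
    exists_le_of_sum_le (hM.good_nonempty h.succ)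
      ((hM.followProb_expert h.succ).trans (hM.sum_good_empiricalDist hN hD h.succ).symm).le
  have hnonneg (x : S) (hx : x ∈ good) :
      0 ≤ (empiricalDist D h.succ x a₁ - M.occupancy π h.succ x a₁)⁺ -
        (empiricalDist D h.succ x a₁ - M.occupancy πE h.succ x a₁)⁺ :=
    sub_nonneg.2 (posPart_mono (sub_le_sub_left (hM.occupancy_le_expert π _ hx) _))
  calc c * (1 - M.followProb π good a₁ h.castSucc)
      ≤ M.occupancy πE h.succ s a₁ - M.occupancy π h.succ s a₁ :=
        hM.mul_one_sub_followProb_le_occupancy_sub π hs (hc s hs)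
    _ ≤ (empiricalDist D h.succ s a₁ - M.occupancy π h.succ s a₁)⁺ -
          (empiricalDist D h.succ s a₁ - M.occupancy πE h.succ s a₁)⁺ := by
        rw [posPart_of_nonneg (sub_nonneg.2 hle)]
        linarith [le_posPart (empiricalDist D h.succ s a₁ - M.occupancy π h.succ s a₁)]
    _ ≤ _ := by
        rw [uncoveredMass, uncoveredMass, ← sum_sub_distrib]
        exact single_le_sum hnonneg hs

end OneStep

theorem value_sub_value_le {M : TabularMDP S A (n + 2)} {πE : Policy S A (n + 2)}
    {good : Finset S} {a₁ : A} (hM : M.IsRBAS πE good a₁) (hN : N ≠ 0)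
    {D : Dataset S A (n + 2) N} (hD : 0 < M.datasetProb πE D) {π : Policy S A (n + 2)} {c ε : ℝ}
    (hc₀ : 0 < c) (hc : ∀ h : Fin (n + 1), ∀ s ∈ good, ∀ x ∈ good,
      c ≤ M.trans h.castSucc x a₁ s)
    (hopt : M.tvLoss D π ≤ M.tvLoss D πE + ε) :
    M.value πE - M.value π ≤ M.uncoveredMass πE good a₁ D (Fin.last (n + 1)) + ε / c := by
  set excess : Fin (n + 2) → ℝ := fun h =>
    M.uncoveredMass π good a₁ D h - M.uncoveredMass πE good a₁ D h with hexcess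
  have excess_nonneg (h : Fin (n + 2)) : 0 ≤ excess h :=
    sub_nonneg.2 (hM.uncoveredMass_expert_le π D h)
  have sum_excess : 2 * ∑ h, excess h ≤ ε := by
    rw [hM.tvLoss_eq_two_mul_sum_uncoveredMass hN hD,
      hM.tvLoss_eq_two_mul_sum_uncoveredMass hN hD] at hopt
    rw [hexcess, sum_sub_distrib]
    linarith
  have gap_init : c * ∑ h : Fin (n + 1), (1 - M.followProb π good a₁ h.castSucc) ≤
      ∑ h, excess h := by
    rw [mul_sum, Fin.sum_univ_succ excess]
    exact le_add_of_nonneg_of_le (excess_nonneg 0) <| sum_le_sum fun h _ =>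
      hM.mul_one_sub_followProb_le_uncoveredMass_sub hN hD π (hc h)
  have gap_last : 1 - M.followProb π good a₁ (Fin.last (n + 1)) -
      M.uncoveredMass πE good a₁ D (Fin.last (n + 1)) ≤ ∑ h, excess h :=
    (sub_le_sub_right (hM.one_sub_followProb_le_uncoveredMass hN hD π _) _).trans
      (single_le_sum (fun h _ => excess_nonneg h) (mem_univ (Fin.last (n + 1))))
  have gap_eq : M.value πE - M.value π =
      ∑ h : Fin (n + 1), (1 - M.followProb π good a₁ h.castSucc) +
        (1 - M.followProb π good a₁ (Fin.last (n + 1))) := by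
    rw [hM.value_eq_sum_followProb, hM.value_eq_sum_followProb, ← sum_sub_distrib,
      Fin.sum_univ_castSucc]
    simp only [hM.followProb_expert]
  have c_le_one : c ≤ 1 := by
    obtain ⟨s, hs⟩ := hM.good_nonempty 0
    exact (hc 0 s hs s hs).trans (mem_Icc_of_mem_stdSimplex (M.trans_mem _ s a₁) s).2
  have gap_last_mul := (mul_le_mul_of_nonneg_left gap_last hc₀.le).trans
    (mul_le_of_le_one_left (sum_nonneg fun h _ => excess_nonneg h) c_le_one)
  rw [gap_eq, ← sub_le_iff_le_add', le_div_iff₀ hc₀]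
  linarith

section Candidates

variable {M : TabularMDP S A H} {πE π : Policy S A H} {good : Finset S} {a₁ : A}

theorem visitAfter_pos (hM : M.IsRBAS πE good a₁) (hπ : IsCandidate good a₁ π) {ℓ : Fin H}
    {s' : S} (hs' : s' ∈ good) {k : ℕ} (hk : ℓ + k < H) {s : S} (hs : s ∈ good) :
    0 < M.visitAfter π ℓ s' a₁ k s := by
  induction k generalizing s with
  | zero => exact hM.trans_expert ℓ s' hs' s hs
  | succ k ih =>
    have hk' : (ℓ : ℕ) + k + 1 < H := hk
    obtain ⟨x, hx, hprob⟩ := hπ ⟨ℓ + k + 1, hk'⟩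
    have hterm (y : S) (b : A) : 0 ≤ M.visitAfter π ℓ s' a₁ k y *
        π.prob ⟨ℓ + k + 1, hk'⟩ y b * M.trans ⟨ℓ + k + 1, hk'⟩ y b s :=
      mul_nonneg (mul_nonneg (M.visitAfter_nonneg π ℓ s' a₁ k y) ((π.prob_mem _ y).1 b))
        ((M.trans_mem _ y b).1 s)
    rw [visitAfter, dif_pos hk']
    refine sum_pos' (fun y _ => sum_nonneg fun b _ => hterm y b) ⟨x, mem_univ x, ?_⟩
    refine sum_pos' (fun b _ => hterm x b) ⟨a₁, mem_univ a₁, ?_⟩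
    exact mul_pos (mul_pos (ih (by omega) hx) hprob) (hM.trans_expert _ x hx s hs)

theorem minVisitProb_pos (hM : M.IsRBAS πE good a₁) (hH : 2 ≤ H) (hπ : IsCandidate good a₁ π) :
    0 < M.minVisitProb good a₁ π := by
  obtain ⟨g, hg⟩ := hM.good_nonempty ⟨0, by omega⟩
  obtain ⟨ℓ, h, hℓ, s, hs, s', hs', hmin⟩ : M.minVisitProb good a₁ π ∈ _ :=
    Set.Nonempty.csInf_mem
      ⟨_, ⟨0, by omega⟩, ⟨1, by omega⟩, Fin.mk_lt_mk.2 one_pos, g, hg, g, hg, rfl⟩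
      (M.finite_setOf_visitProb good a₁ π)
  rw [hmin]
  exact hM.visitAfter_pos hπ hs' (by omega) hs

end Candidates

end IsRBAS

end TabularMDP

theorem mainTheorem3_general {S A : Type*} [Fintype S] [Fintype A] [DecidableEq S]
    [DecidableEq A] {n N : ℕ} (hN : N ≠ 0) {M : TabularMDP S A (n + 2)}
    {πE : Policy S A (n + 2)} {good : Finset S} {a₁ : A} (hM : M.IsRBAS πE good a₁)
    {c ε : Dataset S A (n + 2) N → ℝ} {π : Dataset S A (n + 2) N → Policy S A (n + 2)}
    (hc₀ : ∀ D, 0 < M.datasetProb πE D → 0 < c D)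
    (hc : ∀ D, 0 < M.datasetProb πE D → ∀ h : Fin (n + 1), ∀ s ∈ good, ∀ s' ∈ good,
      c D ≤ M.trans h.castSucc s' a₁ s)
    (hopt : ∀ D, 0 < M.datasetProb πE D → M.tvLoss D (π D) ≤ M.tvLoss D πE + ε D) :
    M.value πE - M.datasetExp πE (fun D => M.value (π D)) ≤
      min 1 √(#good / N) + M.datasetExp πE fun D => ε D / c D := by
  let err : Dataset S A (n + 2) N → ℝ := fun D => M.uncoveredMass πE good a₁ D (Fin.last (n + 1))
  have hgap : M.value πE ≤ M.datasetExp πE (fun D => M.value (π D)) +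
      (M.datasetExp πE err + M.datasetExp πE fun D => ε D / c D) := by
    rw [← M.datasetExp_const πE (N := N) (M.value πE), ← M.datasetExp_add, ← M.datasetExp_add]
    exact TabularMDP.datasetExp_mono fun D hD => sub_le_iff_le_add'.1 <|
      hM.value_sub_value_le hN hD (hc₀ D hD) (hc D hD) (hopt D hD)
  have herr_one : M.datasetExp πE err ≤ 1 :=
    (TabularMDP.datasetExp_mono fun D _ => M.uncoveredMass_le_one hN πE good a₁ D _).trans_eq
      (M.datasetExp_const πE 1)
  have herr_sqrt : M.datasetExp πE err ≤ √(#good / N) :=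
    M.datasetExp_uncoveredMass_le_sqrt hN πE good a₁ _
  linarith [le_min herr_one herr_sqrt]

theorem mainTheorem3 :
    ∃ C : ℝ, 0 < C ∧
      ∀ (S A : Type*) [Fintype S] [DecidableEq S] [Fintype A] [DecidableEq A]
        (H N : ℕ) (_hH : 2 ≤ H) (_hN : 1 ≤ N)
        (M : TabularMDP S A H) (πE : Policy S A H) (good : Finset S) (a₁ : A)
        (_hM : M.IsRBAS πE good a₁)
        (ε : ℝ) (πbar : Dataset S A H N → Policy S A H)
        (_hcand : ∀ D, 0 < M.datasetProb πE D → TabularMDP.IsCandidate good a₁ (πbar D))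
        (_hopt : ∀ D, 0 < M.datasetProb πE D → M.IsEpsOptimal D ε (πbar D)),
        (∀ D, 0 < M.datasetProb πE D → 0 < M.minVisitProb good a₁ (πbar D)) ∧
        M.value πE - M.datasetExp πE (fun D => M.value (πbar D)) ≤
          C * min
            (1 + M.datasetExp πE (fun D => 8 * ε / M.minVisitProb good a₁ (πbar D)))
            (√((Fintype.card S : ℝ) / N) +
              M.datasetExp πE (fun D => 8 * ε / M.minVisitProb good a₁ (πbar D))) := by
  refine ⟨1, one_pos, fun S A _ _ _ _ H N hH hN M πE good a₁ hM ε πbar hcand hopt => ?_⟩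
  have hpos D (hD : 0 < M.datasetProb πE D) : 0 < M.minVisitProb good a₁ (πbar D) :=
    hM.minVisitProb_pos hH (hcand D hD)
  refine ⟨hpos, ?_⟩
  obtain ⟨n, rfl⟩ := Nat.exists_eq_add_of_le' hH
  rw [one_mul, min_add_add_right]
  have hopt' D (hD : 0 < M.datasetProb πE D) :
      M.tvLoss D (πbar D) ≤ M.tvLoss D πE + 8 * ε := by
    linarith [hopt D hD πE, (hopt D hD).nonneg]
  refine (mainTheorem3_general (by omega) hM hpos
    (fun D _ h _ hs _ hs' => M.minVisitProb_le_trans a₁ (πbar D) h hs hs') hopt').trans ?_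
  gcongr
  exact card_le_univ good
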